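/- Let $N\ge 1$ and $m_D\ge 1$ be integers and let $m_I>0$, $\lambda>0$, $\alpha>2$, $d>0$, $\mathrm{SNR}>0$, $T>0$ be real numbers. Let $\Phi=\{x_i\}_{i\ge 0}$ be a stationary Poisson point process on $\mathbb{R}^2$ of density $\lambda$ (the interferer locations). Let $g_1,\dots,g_N$ (fading gains of the desired links) be Gamma distributed with shape $m_D$ and scale $1/m_D$, and let $h_{n,i}$, $1\le n\le N$, $i\ge 0$ (fading gain from the $i$-th interferer to the $n$-th antenna), be Gamma distributed with shape $m_I$ and scale $1/m_I$. In the full-correlation (FC) model the interferer gains coincide on all branches, $h_{n,i}=h_{n',i}$ almost surely for all $n,n',i$; apart from this, everything is independent: for each $n$, the random variables $g_1,\dots,g_N,h_{n,0},h_{n,1},\dots$ are mutually independent, and this family is independent of the locations $(x_i)_{i\ge0}$. Let $$I_n=d^{\alpha}\sum_{i\ge 0}h_{n,i}\,\|x_i\|^{-\alpha},\qquad \mathrm{SINR}^{\mathrm{FC}}_{\mathrm{MRC}}=\sum_{n=1}^{N}\frac{g_n}{I_n+\mathrm{SNR}^{-1}}$$ be the interference power on branch $n$ and the post-combiner SINR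 of $N$-branch maximal-ratio combining (MRC). Then the success probability is $$\mathbb{P}\bigl(\mathrm{SINR}^{\mathrm{FC}}_{\mathrm{MRC}}\ge T\bigr)=\sum_{k=0}^{Nm_D-1}\frac{(-1)^k}{k!}\,\frac{\partial^k}{\partial s^k}\left[\exp\left(-\frac{s\,m_D\,T}{\mathrm{SNR}}-\lambda\pi d^{2}s^{2/\alpha}T^{2/\alpha}\,\Gamma(1-2/\alpha)\,\frac{\Gamma(2/\alpha+m_I)}{\Gamma(m_I)}\left(\frac{m_D}{m_I}\right)^{2/\alpha}\right)\right]_{s=1}.$$ -/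

import Mathlib

open MeasureTheory ProbabilityTheory
open scoped ENNReal Nat

/-- The Euclidean plane. -/
abbrev Plane : Type := EuclideanSpace ℝ (Fin 2)

/-- The number of points (counted with multiplicity) of the random sequence `x` that lie in `B`. -/
noncomputable def pointCount {Ω : Type*} (x : ℕ → Ω → Plane) (B : Set Plane) (ω : Ω) : ℕ∞ :=
  Set.encard {i : ℕ | x i ω ∈ B}

/-- The random points `x 0, x 1, …` enumerate a stationary planar Poisson point process of
density `lam`: the number of points in a Borel set of finite area is Poisson distributed with
mean `lam * area`, and the numbers of points in pairwise disjoint Borel sets are independent. -/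
structure IsPlanarPoissonProcess {Ω : Type*} [MeasurableSpace Ω] (μ : Measure Ω) (lam : ℝ)
    (x : ℕ → Ω → Plane) : Prop where
  measurable_point : ∀ i, Measurable (x i)
  count_law : ∀ B : Set Plane, MeasurableSet B → volume B ≠ ∞ → ∀ k : ℕ,
    μ {ω | pointCount x B ω = k} = poissonMeasure (lam * (volume B).toReal).toNNReal {k}
  count_indep : ∀ (n : ℕ) (B : Fin n → Set Plane), (∀ j, MeasurableSet (B j)) →
    Pairwise (fun j l => Disjoint (B j) (B l)) → iIndepFun (fun j => pointCount x (B j)) μ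

/-- The full-correlation model with `N` branches. `x i` is the location of the `i`-th interferer,
`g n` the power fading gain from the desired transmitter to the `n`-th antenna and `h n i` the
power fading gain from the `i`-th interferer to the `n`-th antenna. The gains are Gamma
distributed with mean one (Nakagami fading with parameters `mD` and `mI`). The interferer gains
are identical on all branches; apart from that, all gains and the locations are independent. -/
structure IsFullCorrelationModel {Ω : Type*} [MeasurableSpace Ω] (μ : Measure Ω) (N : ℕ)
    (lam mD mI : ℝ) (x : ℕ → Ω → Plane) (g : Fin N → Ω → ℝ) (h : Fin N → ℕ → Ω → ℝ) : Prop where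
  poisson : IsPlanarPoissonProcess μ lam x
  measurable_g : ∀ n, Measurable (g n)
  measurable_h : ∀ n i, Measurable (h n i)
  law_g : ∀ n, μ.map (g n) = gammaMeasure mD mD
  law_h : ∀ n i, μ.map (h n i) = gammaMeasure mI mI
  full_correlation : ∀ n n' i, h n i =ᵐ[μ] h n' i
  indep_gains : ∀ n, iIndepFun (Sum.elim g (h n)) μ
  indep_locations : ∀ n, IndepFun (fun ω i => x i ω)
    (fun ω (j : Fin N ⊕ ℕ) => Sum.elim g (h n) j ω) μ

/-- The interference power `d ^ α * ∑ i, h i * ‖x i‖ ^ (-α)` on a branch with interferer gains `h`,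
as a value in `[0, ∞]`. -/
noncomputable def interference {Ω : Type*} (α d : ℝ) (x : ℕ → Ω → Plane) (h : ℕ → Ω → ℝ)
    (ω : Ω) : ℝ≥0∞ :=
  ENNReal.ofReal (d ^ α) * ∑' i, ENNReal.ofReal (h i ω) * ‖x i ω‖ₑ ^ (-α)

/-- The post-combiner SINR `∑ n, g n / (I n + SNR⁻¹)` of `N`-branch maximal-ratio combining. -/
noncomputable def sinrMRC {Ω : Type*} {N : ℕ} (α d SNR : ℝ) (x : ℕ → Ω → Plane)
    (g : Fin N → Ω → ℝ) (h : Fin N → ℕ → Ω → ℝ) (ω : Ω) : ℝ≥0∞ :=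
  ∑ n, ENNReal.ofReal (g n ω) / (interference α d x (h n) ω + ENNReal.ofReal SNR⁻¹)

/-! Full correlation makes the interference `I` the same on all branches almost surely, so the SINR
is `G / (I + SNR⁻¹)` with `G = ∑ g n`. As a sum of independent Gamma variables with common rate
`mD`, `G` is Gamma with integer shape `M = N * mD` (`map_sum_eq_gammaMeasure`), and it is
independent of `Y = T * (I + SNR⁻¹)`. The success event is `Y ≤ G`.

The tail of a Gamma law of integer shape is the finite sum of `(mD * Y)^k / k! * exp (-(mD * Y))`
over `k < M`. Its expectation is a combination of derivatives at `s = 1` of the Laplace transform `L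
s` of `mD * Y` (`measureReal_le_eq_sum_iteratedDeriv`).

It remains to find `L`. The noise contributes a deterministic exponential. For `I`, the fading gains
are integrated out given the locations, and the Laplace functional of the Poisson process is applied
to what is left (`lintegral_expNeg_tsum_mul`). A layer-cake computation over discs gives `π * Γ(1 -
2/α)`, and the fractional moment of order `2/α` of the gain gives the remaining Gamma quotient.

Laplace functionals take values in `[0, ∞]`, so infinite sums and integrals need no convergence
hypotheses. -/

open Filter Topology

/-! ### The negative exponential on `[0, ∞]`. -/

/-- The function `t ↦ exp (-t)` on `[0, ∞]`. -/
noncomputable def expNeg (t : ℝ≥0∞) : ℝ≥0∞ := (EReal.exp t)⁻¹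

@[simp] lemma expNeg_zero : expNeg 0 = 1 := by simp [expNeg]

@[simp] lemma expNeg_top : expNeg ∞ = 0 := by simp [expNeg]

lemma expNeg_ofReal {a : ℝ} (ha : 0 ≤ a) :
    expNeg (ENNReal.ofReal a) = ENNReal.ofReal (Real.exp (-a)) := by
  rw [expNeg, EReal.coe_ennreal_ofReal, max_eq_left ha, EReal.exp_coe, Real.exp_neg,
    ENNReal.ofReal_inv_of_pos (Real.exp_pos a)]

lemma expNeg_antitone : Antitone expNeg := fun _ _ hab =>
  ENNReal.inv_le_inv.2 (EReal.exp_monotone (EReal.coe_ennreal_le_coe_ennreal_iff.2 hab))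

lemma expNeg_le_one (a : ℝ≥0∞) : expNeg a ≤ 1 :=
  (expNeg_antitone (zero_le (a := a))).trans_eq expNeg_zero

lemma expNeg_ne_top (a : ℝ≥0∞) : expNeg a ≠ ∞ :=
  ((expNeg_le_one a).trans_lt ENNReal.one_lt_top).ne

lemma continuous_expNeg : Continuous expNeg :=
  continuous_inv.comp (ENNReal.continuous_exp.comp continuous_coe_ennreal_ereal)

@[fun_prop]
lemma measurable_expNeg : Measurable expNeg := continuous_expNeg.measurable

lemma expNeg_add (a b : ℝ≥0∞) : expNeg (a + b) = expNeg a * expNeg b := by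
  have h : ∀ c : ℝ≥0∞, EReal.exp c ≠ 0 := fun c => by simp
  rw [expNeg, expNeg, expNeg, EReal.coe_ennreal_add, EReal.exp_add,
    ENNReal.mul_inv (Or.inl (h a)) (Or.inr (h b))]

lemma expNeg_sum {ι : Type*} (s : Finset ι) (f : ι → ℝ≥0∞) :
    expNeg (∑ i ∈ s, f i) = ∏ i ∈ s, expNeg (f i) := by
  classical
  induction s using Finset.induction_on with
  | empty => simp
  | insert a s ha ih => rw [Finset.sum_insert ha, Finset.prod_insert ha, expNeg_add, ih]

lemma tendsto_prod_expNeg (f : ℕ → ℝ≥0∞) :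
    Tendsto (fun n => ∏ i ∈ Finset.range n, expNeg (f i)) atTop (𝓝 (expNeg (∑' i, f i))) := by
  simp_rw [← expNeg_sum]
  exact (continuous_expNeg.tendsto _).comp ENNReal.summable.hasSum.tendsto_sum_nat

/-- Every number in `[0, 1]` is a value of `expNeg`, with a measurable choice of preimage. -/
lemma exists_measurable_rightInverse_expNeg :
    ∃ L : ℝ≥0∞ → ℝ≥0∞, Measurable L ∧ ∀ p ≤ 1, expNeg (L p) = p := by
  refine ⟨fun p => (ENNReal.log p⁻¹).toENNReal, ?_, fun p hp => ?_⟩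
  · exact (ENNReal.measurable_log.comp measurable_inv).ereal_toENNReal
  · have : 0 ≤ ENNReal.log p⁻¹ := by simpa using hp
    rw [expNeg, EReal.coe_toENNReal this, ENNReal.exp_log, inv_inv]

/-- Layer-cake form: after Tonelli, integrals of `1 - expNeg (u y)` over the plane reduce to areas
of superlevel sets of `u`. The indicator form also covers `a = ∞`. -/
lemma one_sub_expNeg_eq_lintegral (a : ℝ≥0∞) :
    1 - expNeg a = ∫⁻ t in Set.Ioi (0 : ℝ),
      ENNReal.ofReal (Real.exp (-t)) * (Set.indicator {t : ℝ | ENNReal.ofReal t < a} 1 t) := by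
  have hm : MeasurableSet {t : ℝ | ENNReal.ofReal t < a} :=
    measurableSet_lt ENNReal.measurable_ofReal measurable_const
  have key : ∀ s : ℝ, 0 ≤ s → ∫⁻ t in Set.Ioi s, ENNReal.ofReal (Real.exp (-t))
      = ENNReal.ofReal (Real.exp (-s)) := fun s hs => by
    rw [← ofReal_integral_eq_lintegral_ofReal (integrableOn_exp_neg_Ioi s)
      (ae_of_all _ fun t => (Real.exp_pos _).le), integral_exp_neg_Ioi]
  have h1 : ∀ t : ℝ, ENNReal.ofReal (Real.exp (-t)) *
      (Set.indicator {t : ℝ | ENNReal.ofReal t < a} 1 t) =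
      Set.indicator {t : ℝ | ENNReal.ofReal t < a} (fun t => ENNReal.ofReal (Real.exp (-t))) t := by
    intro t; by_cases h : ENNReal.ofReal t < a <;> simp [h]
  simp_rw [h1]
  rw [setLIntegral_indicator hm]
  induction a with
  | top => simpa using (key 0 le_rfl).symm
  | coe b =>
    have hset : {t : ℝ | ENNReal.ofReal t < b} ∩ Set.Ioi 0 = Set.Ioo 0 (b : ℝ) := by
      ext t
      simp only [Set.mem_inter_iff, Set.mem_ofPred_eq, Set.mem_Ioi, Set.mem_Ioo]
      rw [and_comm, and_congr_right_iff]
      intro ht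
      rw [ENNReal.ofReal_lt_coe_iff ht.le]
    rw [hset]
    have hb : (b : ℝ≥0∞) = ENNReal.ofReal b := by simp
    have hu : ∫⁻ t in Set.Ioi (0 : ℝ), ENNReal.ofReal (Real.exp (-t)) =
        (∫⁻ t in Set.Ioo 0 (b : ℝ), ENNReal.ofReal (Real.exp (-t))) +
        ∫⁻ t in Set.Ioi (b : ℝ), ENNReal.ofReal (Real.exp (-t)) := by
      rw [← Set.Ioc_union_Ioi_eq_Ioi b.coe_nonneg, lintegral_union measurableSet_Ioi
        (Set.disjoint_left.2 fun t h1 h2 => not_lt.2 h1.2 h2), setLIntegral_congr Ioo_ae_eq_Ioc]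
    rw [key 0 le_rfl, key b b.coe_nonneg, ← expNeg_ofReal b.coe_nonneg, ← hb] at hu
    simp only [neg_zero, Real.exp_zero, ENNReal.ofReal_one] at hu
    rw [hu, ENNReal.add_sub_cancel_right (expNeg_ne_top _)]

lemma expNeg_mul_natCast (a : ℝ≥0∞) (k : ℕ) : expNeg (a * k) = expNeg a ^ k := by
  induction k with
  | zero => simp
  | succ k ih => rw [Nat.cast_succ, mul_add, mul_one, expNeg_add, ih, pow_succ]

/-! ### Poisson counts and the Laplace functional of the point process. -/

/-- `count_law` prescribes only the finite counts; the mass at `⊤` is forced by total mass one. -/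
lemma measure_singleton_top_enat (ρ : Measure ℕ∞) [IsProbabilityMeasure ρ] :
    ρ {⊤} = 1 - ∑' k : ℕ, ρ {(k : ℕ∞)} := by
  have h : ({⊤} : Set ℕ∞)ᶜ = ⋃ k : ℕ, {(k : ℕ∞)} := by
    ext k
    induction k <;> simp
  rw [← measure_iUnion (fun i j hij => by simpa using hij) (fun _ => .of_discrete), ← h,
    ← prob_compl_eq_one_sub .of_discrete, compl_compl]

lemma lintegral_poissonMeasure (r : NNReal) (f : ℕ → ℝ≥0∞) :
    ∫⁻ k, f k ∂poissonMeasure r = ∑' k, ENNReal.ofReal (Real.exp (-r) * r ^ k / k !) * f k := by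
  simp [poissonMeasure, lintegral_sum_measure]

lemma lintegral_poissonMeasure_pow (r : NNReal) {q : ℝ≥0∞} (hq : q ≤ 1) :
    ∫⁻ k, q ^ k ∂poissonMeasure r = expNeg (r * (1 - q)) := by
  have hq' : q ≠ ∞ := (hq.trans_lt ENNReal.one_lt_top).ne
  lift q to NNReal using hq'
  have hq1 : (q : ℝ) ≤ 1 := by exact_mod_cast hq
  have h1 : (r : ℝ≥0∞) * (1 - q) = ENNReal.ofReal (r * (1 - q)) := by
    rw [ENNReal.ofReal_mul r.coe_nonneg, ENNReal.ofReal_sub _ q.coe_nonneg]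
    simp
  have hs := NormedSpace.expSeries_div_hasSum_exp ((r : ℝ) * q)
  rw [← Real.exp_eq_exp_ℝ] at hs
  have hs := hs.mul_left (Real.exp (-r))
  rw [lintegral_poissonMeasure, h1, expNeg_ofReal (mul_nonneg r.coe_nonneg (by linarith))]
  have h2 : ∀ k : ℕ, ENNReal.ofReal (Real.exp (-r) * r ^ k / k !) * (q : ℝ≥0∞) ^ k =
      ENNReal.ofReal (Real.exp (-r) * ((r * q) ^ k / k !)) := fun k => by
    have : (q : ℝ≥0∞) ^ k = ENNReal.ofReal ((q : ℝ) ^ k) := by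
      rw [ENNReal.ofReal_pow q.coe_nonneg]; simp
    rw [this, ← ENNReal.ofReal_mul (by positivity)]
    congr 1
    ring
  simp_rw [h2]
  rw [← ENNReal.ofReal_tsum_of_nonneg (fun k => by positivity) hs.summable, hs.tsum_eq,
    ← Real.exp_add]
  congr 2
  ring

lemma tsum_indicator_eq_mul_pointCount {Ω : Type*} (x : ℕ → Ω → Plane) (B : Set Plane) (c : ℝ≥0∞)
    (ω : Ω) :
    ∑' i, B.indicator (fun _ => c) (x i ω) = c * (pointCount x B ω : ℝ≥0∞) := by
  rw [pointCount, ← ENNReal.tsum_set_one, ← ENNReal.tsum_mul_left,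
    tsum_subtype {i | x i ω ∈ B} (fun _ => c * 1)]
  refine tsum_congr fun i => ?_
  by_cases h : x i ω ∈ B <;> simp [h]

section PoissonProcess

variable {Ω : Type*} [MeasurableSpace Ω] {μ : Measure Ω} {lam : ℝ} {x : ℕ → Ω → Plane}

lemma measurable_pointCount (hx : ∀ i, Measurable (x i)) {B : Set Plane} (hB : MeasurableSet B) :
    Measurable (pointCount x B) := by
  have h1 : Measurable fun ω => ∑' i, B.indicator (fun _ => (1 : ℝ≥0∞)) (x i ω) :=
    Measurable.tsum fun i => (measurable_const.indicator hB).comp (hx i)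
  simp_rw [tsum_indicator_eq_mul_pointCount, one_mul] at h1
  refine measurable_to_countable' fun k => ?_
  have : pointCount x B ⁻¹' {k} = (fun ω => (pointCount x B ω : ℝ≥0∞)) ⁻¹' {(k : ℝ≥0∞)} := by
    ext ω; simp
  rw [this]
  exact h1 (measurableSet_singleton _)

lemma IsPlanarPoissonProcess.map_pointCount [IsProbabilityMeasure μ]
    (hP : IsPlanarPoissonProcess μ lam x) {B : Set Plane} (hB : MeasurableSet B)
    (hBf : volume B ≠ ∞) :
    μ.map (pointCount x B) =
      (poissonMeasure (lam * (volume B).toReal).toNNReal).map (Nat.cast : ℕ → ℕ∞) := by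
  have hm := measurable_pointCount hP.measurable_point hB
  have : IsProbabilityMeasure (μ.map (pointCount x B)) :=
    Measure.isProbabilityMeasure_map hm.aemeasurable
  have : IsProbabilityMeasure ((poissonMeasure (lam * (volume B).toReal).toNNReal).map
      (Nat.cast : ℕ → ℕ∞)) := Measure.isProbabilityMeasure_map (by fun_prop)
  have key : ∀ k : ℕ, μ.map (pointCount x B) {(k : ℕ∞)} =
      (poissonMeasure (lam * (volume B).toReal).toNNReal).map (Nat.cast : ℕ → ℕ∞) {(k : ℕ∞)} := by
    intro k
    rw [Measure.map_apply hm (measurableSet_singleton _),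
      Measure.map_apply (by fun_prop) (measurableSet_singleton _)]
    have h1 : (Nat.cast : ℕ → ℕ∞) ⁻¹' {(k : ℕ∞)} = {k} := by ext; simp
    rw [h1, ← hP.count_law B hB hBf k]
    rfl
  refine Measure.ext_of_singleton fun k => ?_
  induction k with
  | top => simp_rw [measure_singleton_top_enat, key]
  | coe k => exact key k

lemma IsPlanarPoissonProcess.lintegral_expNeg_mul_pointCount [IsProbabilityMeasure μ]
    (hP : IsPlanarPoissonProcess μ lam x) (hlam : 0 ≤ lam) {B : Set Plane} (hB : MeasurableSet B)
    (hBf : volume B ≠ ∞) (a : ℝ≥0∞) :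
    ∫⁻ ω, expNeg (a * (pointCount x B ω : ℝ≥0∞)) ∂μ =
      expNeg (ENNReal.ofReal lam * (volume B * (1 - expNeg a))) := by
  have hm := measurable_pointCount hP.measurable_point hB
  rw [← lintegral_map (f := fun k : ℕ∞ => expNeg (a * (k : ℝ≥0∞))) (by fun_prop) hm,
    hP.map_pointCount hB hBf, lintegral_map (by fun_prop) (by fun_prop)]
  simp only [ENat.toENNReal_coe, expNeg_mul_natCast]
  rw [lintegral_poissonMeasure_pow _ (expNeg_le_one a), ← mul_assoc]
  congr 2
  rw [← ENNReal.ofReal, ENNReal.ofReal_mul hlam, ENNReal.ofReal_toReal hBf]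

lemma IsPlanarPoissonProcess.lintegral_expNeg_sum_indicator [IsProbabilityMeasure μ]
    (hP : IsPlanarPoissonProcess μ lam x) (hlam : 0 ≤ lam) {n : ℕ} {B : Fin n → Set Plane}
    (hB : ∀ j, MeasurableSet (B j)) (hBf : ∀ j, volume (B j) ≠ ∞)
    (hd : Pairwise (fun j l => Disjoint (B j) (B l))) (c : Fin n → ℝ≥0∞) :
    ∫⁻ ω, expNeg (∑' i, ∑ j, (B j).indicator (fun _ => c j) (x i ω)) ∂μ =
      expNeg (ENNReal.ofReal lam *
        ∫⁻ y, (1 - expNeg (∑ j, (B j).indicator (fun _ => c j) y))) := by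
  have h1 : ∀ ω, expNeg (∑' i, ∑ j, (B j).indicator (fun _ => c j) (x i ω)) =
      ∏ j, expNeg (c j * (pointCount x (B j) ω : ℝ≥0∞)) := fun ω => by
    rw [← expNeg_sum, Summable.tsum_finsetSum fun _ _ => ENNReal.summable]
    simp_rw [tsum_indicator_eq_mul_pointCount]
  -- By disjointness at most one indicator is nonzero at `y`, so `1 - expNeg` passes through the
  -- sum.
  have h2 : ∀ y, 1 - expNeg (∑ j, (B j).indicator (fun _ => c j) y) =
      ∑ j, (B j).indicator (fun _ => 1 - expNeg (c j)) y := fun y => by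
    by_cases hy : ∃ j, y ∈ B j
    · obtain ⟨j, hj⟩ := hy
      have hne : ∀ l, l ≠ j → y ∉ B l := fun l hl h => Set.disjoint_left.1 (hd hl) h hj
      rw [Finset.sum_eq_single j (fun l _ hl => Set.indicator_of_notMem (hne l hl) _) (by simp),
        Finset.sum_eq_single j (fun l _ hl => Set.indicator_of_notMem (hne l hl) _) (by simp)]
      simp [hj]
    · push Not at hy
      simp [hy]
  simp_rw [h1, h2]
  have hind : iIndepFun (fun j ω => expNeg (c j * (pointCount x (B j) ω : ℝ≥0∞))) μ :=
    (hP.count_indep n B hB hd).comp (fun j k => expNeg (c j * (k : ℝ≥0∞))) fun j => by fun_prop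
  rw [lintegral_prod_eq_prod_lintegral_of_indepFun _ _ hind fun j =>
    (by fun_prop : Measurable fun k : ℕ∞ => expNeg (c j * (k : ℝ≥0∞))).comp
      (measurable_pointCount hP.measurable_point (hB j)),
    lintegral_finsetSum _ fun j _ => measurable_const.indicator (hB j), Finset.mul_sum, expNeg_sum]
  refine Finset.prod_congr rfl fun j _ => ?_
  rw [hP.lintegral_expNeg_mul_pointCount hlam (hB j) (hBf j), lintegral_indicator_const (hB j),
    mul_comm (volume (B j))]

lemma IsPlanarPoissonProcess.lintegral_expNeg_simpleFunc [IsProbabilityMeasure μ]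
    (hP : IsPlanarPoissonProcess μ lam x) (hlam : 0 ≤ lam) {s : SimpleFunc Plane ℝ≥0∞}
    (hs : s.FinMeasSupp volume) :
    ∫⁻ ω, expNeg (∑' i, s (x i ω)) ∂μ =
      expNeg (ENNReal.ofReal lam * ∫⁻ y, (1 - expNeg (s y))) := by
  classical
  -- The value `0` is dropped because its level set has infinite area; the other level sets are
  -- disjoint and of finite area.
  let R := s.range.filter (· ≠ 0)
  let e : Fin (Fintype.card R) ≃ R := (Fintype.equivFin R).symm
  have h := hP.lintegral_expNeg_sum_indicator hlam (B := fun j => s ⁻¹' {(e j : ℝ≥0∞)})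
    (fun j => s.measurableSet_fiber _)
    (fun j => (hs.meas_preimage_singleton_ne_zero (Finset.mem_filter.1 (e j).2).2).ne)
    (fun j l hjl => Disjoint.preimage _ (Set.disjoint_singleton.2 fun h =>
      hjl (e.injective (Subtype.ext h)))) (fun j => e j)
  have hsum : ∀ y, ∑ j, (s ⁻¹' {(e j : ℝ≥0∞)}).indicator (fun _ => (e j : ℝ≥0∞)) y = s y := by
    intro y
    rw [Equiv.sum_comp e (fun r : R => (s ⁻¹' {(r : ℝ≥0∞)}).indicator (fun _ => (r : ℝ≥0∞)) y),
      Finset.sum_coe_sort R (fun r => (s ⁻¹' {r}).indicator (fun _ => r) y)]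
    by_cases hy : s y = 0
    · rw [hy]
      refine Finset.sum_eq_zero fun r hr => Set.indicator_of_notMem (fun h => ?_) _
      exact (Finset.mem_filter.1 hr).2 (by rw [← hy]; exact h.symm)
    · rw [Finset.sum_eq_single (s y)]
      · simp
      · intro r _ hr
        exact Set.indicator_of_notMem (fun h => hr h.symm) _
      · intro h
        exact absurd (Finset.mem_filter.2 ⟨s.mem_range_self y, hy⟩) h
  simp_rw [hsum] at h
  exact h

/-- The Laplace functional of a planar Poisson point process. -/
theorem IsPlanarPoissonProcess.lintegral_expNeg_tsum [IsProbabilityMeasure μ]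
    (hP : IsPlanarPoissonProcess μ lam x) (hlam : 0 ≤ lam) {u : Plane → ℝ≥0∞} (hu : Measurable u) :
    ∫⁻ ω, expNeg (∑' i, u (x i ω)) ∂μ =
      expNeg (ENNReal.ofReal lam * ∫⁻ y, (1 - expNeg (u y))) := by
  -- Cutting off to growing balls gives support of finite area and keeps the approximation
  -- increasing.
  let s : ℕ → SimpleFunc Plane ℝ≥0∞ := fun n =>
    (SimpleFunc.eapprox u n).restrict (Metric.ball 0 n)
  have hsval : ∀ n y, s n y = (Metric.ball (0 : Plane) n).indicator (SimpleFunc.eapprox u n) y :=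
    fun n y => by rw [SimpleFunc.restrict_apply _ measurableSet_ball]
  have hsfin : ∀ n, (s n).FinMeasSupp volume := fun n => by
    rw [SimpleFunc.finMeasSupp_iff_support]
    refine (measure_mono (fun y hy => ?_)).trans_lt (measure_ball_lt_top (x := (0 : Plane)) (r := n))
    by_contra hn
    exact hy (by rw [hsval, Set.indicator_of_notMem hn])
  have hmono : ∀ y, Monotone fun n => s n y := fun y n m hnm => by
    simp only [hsval]
    by_cases hn : y ∈ Metric.ball (0 : Plane) n
    · have hm : y ∈ Metric.ball (0 : Plane) m := Metric.ball_subset_ball (by exact_mod_cast hnm) hn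
      rw [Set.indicator_of_mem hn, Set.indicator_of_mem hm]
      exact SimpleFunc.monotone_eapprox u hnm y
    · rw [Set.indicator_of_notMem hn]; exact zero_le
  have htend : ∀ y, Tendsto (fun n => s n y) atTop (𝓝 (u y)) := fun y => by
    refine (SimpleFunc.tendsto_eapprox hu y).congr' ?_
    obtain ⟨m, hm⟩ := exists_nat_gt ‖y‖
    filter_upwards [eventually_ge_atTop m] with n hn
    have : y ∈ Metric.ball (0 : Plane) n := by
      rw [mem_ball_zero_iff]; exact hm.trans_le (by exact_mod_cast hn)
    rw [hsval, Set.indicator_of_mem this]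
  have htsum : ∀ ω, Tendsto (fun n => ∑' i, s n (x i ω)) atTop (𝓝 (∑' i, u (x i ω))) := fun ω => by
    have := lintegral_tendsto_of_tendsto_of_monotone (μ := Measure.count (α := ℕ))
      (f := fun n i => s n (x i ω)) (F := fun i => u (x i ω))
      (fun n => (measurable_of_countable _).aemeasurable) (ae_of_all _ fun i => hmono (x i ω))
      (ae_of_all _ fun i => htend (x i ω))
    simpa [lintegral_count] using this
  have hL : Tendsto (fun n => ∫⁻ ω, expNeg (∑' i, s n (x i ω)) ∂μ) atTop
      (𝓝 (∫⁻ ω, expNeg (∑' i, u (x i ω)) ∂μ)) := by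
    refine tendsto_lintegral_of_dominated_convergence (fun _ => 1) (fun n => ?_)
      (fun n => ae_of_all _ fun ω => expNeg_le_one _) (by simp)
      (ae_of_all _ fun ω => (continuous_expNeg.tendsto _).comp (htsum ω))
    exact measurable_expNeg.comp
      (Measurable.tsum fun i => (s n).measurable.comp (hP.measurable_point i))
  -- This limit may be infinite, so monotone convergence replaces dominated convergence.
  have hR : Tendsto (fun n => ∫⁻ y, (1 - expNeg (s n y))) atTop (𝓝 (∫⁻ y, (1 - expNeg (u y)))) := by
    refine lintegral_tendsto_of_tendsto_of_monotone
      (fun n => (measurable_const.sub (measurable_expNeg.comp (s n).measurable)).aemeasurable)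
      (ae_of_all _ fun y n m hnm => tsub_le_tsub_left (expNeg_antitone (hmono y hnm)) 1)
      (ae_of_all _ fun y => ?_)
    exact ENNReal.Tendsto.sub tendsto_const_nhds ((continuous_expNeg.tendsto _).comp (htend y))
      (Or.inl ENNReal.one_ne_top)
  have hR' := (continuous_expNeg.tendsto _).comp
    (ENNReal.Tendsto.const_mul hR (Or.inr (ENNReal.ofReal_ne_top (r := lam))))
  refine tendsto_nhds_unique hL (hR'.congr fun n => ?_)
  exact (hP.lintegral_expNeg_simpleFunc hlam (hsfin n)).symm

end PoissonProcess

/-! ### Independent marks. -/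

lemma lintegral_one_sub_expNeg {β : Type*} [MeasurableSpace β] (ν : Measure β)
    [IsProbabilityMeasure ν] {f : β → ℝ≥0∞} (hf : Measurable f) :
    ∫⁻ t, (1 - expNeg (f t)) ∂ν = 1 - ∫⁻ t, expNeg (f t) ∂ν := by
  have h1 : ∫⁻ t, expNeg (f t) ∂ν ≠ ∞ :=
    ((lintegral_mono fun t => expNeg_le_one (f t)).trans_lt (by simp)).ne
  rw [lintegral_sub (g := fun t => expNeg (f t)) (measurable_expNeg.comp hf) h1 (ae_of_all _ fun t => expNeg_le_one _)]
  simp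

/-- The Laplace functional of a weighted sum of independent, identically distributed marks. -/
lemma lintegral_expNeg_tsum_marks {Ω : Type*} [MeasurableSpace Ω] {μ : Measure Ω}
    {h : ℕ → Ω → ℝ} {ν : Measure ℝ} (hm : ∀ i, Measurable (h i)) (hlaw : ∀ i, μ.map (h i) = ν)
    (hind : iIndepFun h μ) {V : ℝ≥0∞ → ℝ≥0∞}
    (hV : ∀ b, expNeg (V b) = ∫⁻ t, expNeg (ENNReal.ofReal t * b) ∂ν) (a : ℕ → ℝ≥0∞) :
    ∫⁻ ω, expNeg (∑' i, ENNReal.ofReal (h i ω) * a i) ∂μ = expNeg (∑' i, V (a i)) := by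
  have : IsProbabilityMeasure μ := hind.isProbabilityMeasure
  have hmeas : ∀ i, Measurable fun t : ℝ => expNeg (ENNReal.ofReal t * a i) := fun i => by fun_prop
  have hL : Tendsto (fun n => ∫⁻ ω, ∏ i ∈ Finset.range n, expNeg (ENNReal.ofReal (h i ω) * a i) ∂μ)
      atTop (𝓝 (∫⁻ ω, expNeg (∑' i, ENNReal.ofReal (h i ω) * a i) ∂μ)) := by
    refine tendsto_lintegral_of_dominated_convergence (fun _ => 1) (fun n => ?_)
      (fun n => ae_of_all _ fun ω => Finset.prod_le_one' fun i _ => expNeg_le_one _) (by simp)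
      (ae_of_all _ fun ω => tendsto_prod_expNeg _)
    exact Finset.measurable_fun_prod _ fun i _ => (hmeas i).comp (hm i)
  refine tendsto_nhds_unique hL ((tendsto_prod_expNeg fun i => V (a i)).congr fun n => ?_)
  rw [lintegral_prod_eq_prod_lintegral_of_indepFun _
    (fun i ω => expNeg (ENNReal.ofReal (h i ω) * a i))
    (hind.comp (fun i t => expNeg (ENNReal.ofReal t * a i)) hmeas) fun i => (hmeas i).comp (hm i)]
  refine Finset.prod_congr rfl fun i _ => ?_
  rw [hV, ← hlaw i, lintegral_map (hmeas i) (hm i)]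

/-- The Laplace functional of the weighted sum over an independently marked planar Poisson
process. -/
theorem IsPlanarPoissonProcess.lintegral_expNeg_tsum_mul {Ω : Type*} [MeasurableSpace Ω]
    {μ : Measure Ω} [IsProbabilityMeasure μ] {lam : ℝ} {x : ℕ → Ω → Plane}
    (hP : IsPlanarPoissonProcess μ lam x) (hlam : 0 ≤ lam) {h : ℕ → Ω → ℝ} {ν : Measure ℝ}
    [IsProbabilityMeasure ν] (hm : ∀ i, Measurable (h i)) (hlaw : ∀ i, μ.map (h i) = ν)
    (hind : iIndepFun h μ) (hxh : IndepFun (fun ω i => x i ω) (fun ω i => h i ω) μ)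
    {f : Plane → ℝ≥0∞} (hf : Measurable f) :
    ∫⁻ ω, expNeg (∑' i, ENNReal.ofReal (h i ω) * f (x i ω)) ∂μ =
      expNeg (ENNReal.ofReal lam * ∫⁻ y, ∫⁻ t, (1 - expNeg (ENNReal.ofReal t * f y)) ∂ν) := by
  -- `V` is minus the logarithm of the Laplace transform of a mark. Averaging over the marks at
  -- fixed locations turns the marked sum into `∑ V (f (x i))`, an unmarked functional of the
  -- points; measurability of `L` makes `V ∘ f` admissible there.
  obtain ⟨L, hLm, hL⟩ := exists_measurable_rightInverse_expNeg
  let V : ℝ≥0∞ → ℝ≥0∞ := fun b => L (∫⁻ t, expNeg (ENNReal.ofReal t * b) ∂ν)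
  have hle : ∀ b, ∫⁻ t, expNeg (ENNReal.ofReal t * b) ∂ν ≤ 1 := fun b =>
    (lintegral_mono fun t => expNeg_le_one _).trans_eq (by simp)
  have hV : ∀ b, expNeg (V b) = ∫⁻ t, expNeg (ENNReal.ofReal t * b) ∂ν := fun b => hL _ (hle b)
  have hVm : Measurable V := hLm.comp <| Measurable.lintegral_prod_right'
    (f := fun p : ℝ≥0∞ × ℝ => expNeg (ENNReal.ofReal p.2 * p.1)) (by fun_prop)
  have hxm : Measurable fun ω i => x i ω := measurable_pi_lambda _ hP.measurable_point
  have hhm : Measurable fun ω i => h i ω := measurable_pi_lambda _ hm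
  let F : (ℕ → Plane) × (ℕ → ℝ) → ℝ≥0∞ := fun p =>
    expNeg (∑' i, ENNReal.ofReal (p.2 i) * f (p.1 i))
  have hF : Measurable F := measurable_expNeg.comp (Measurable.tsum fun i => by fun_prop)
  have hprob : IsProbabilityMeasure (μ.map fun ω i => h i ω) :=
    Measure.isProbabilityMeasure_map hhm.aemeasurable
  calc ∫⁻ ω, F (fun i => x i ω, fun i => h i ω) ∂μ
      = ∫⁻ p, F p ∂(μ.map fun ω => ((fun i => x i ω, fun i => h i ω) :
          (ℕ → Plane) × (ℕ → ℝ))) := (lintegral_map hF (hxm.prodMk hhm)).symm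
    _ = ∫⁻ ξ, ∫⁻ η, F (ξ, η) ∂(μ.map fun ω i => h i ω) ∂(μ.map fun ω i => x i ω) := by
        rw [(indepFun_iff_map_prod_eq_prod_map_map hxm.aemeasurable hhm.aemeasurable).1 hxh,
          lintegral_prod _ hF.aemeasurable]
    _ = ∫⁻ ω, ∫⁻ η, F (fun i => x i ω, η) ∂(μ.map fun ω i => h i ω) ∂μ :=
        lintegral_map hF.lintegral_prod_right' hxm
    _ = ∫⁻ ω, expNeg (∑' i, V (f (x i ω))) ∂μ := by
        refine lintegral_congr fun ω => ?_
        rw [lintegral_map (f := fun η => F (fun i => x i ω, η)) (hF.comp measurable_prodMk_left) hhm]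
        exact lintegral_expNeg_tsum_marks hm hlaw hind hV fun i => f (x i ω)
    _ = _ := by
        rw [hP.lintegral_expNeg_tsum hlam (u := fun y => V (f y)) (hVm.comp hf)]
        congr 2
        refine lintegral_congr fun y => ?_
        rw [lintegral_one_sub_expNeg ν (by fun_prop), hV]

/-! ### Path-loss integral over the plane and fractional Gamma moments. -/

lemma setOf_lt_mul_enorm_rpow_eq_ball {α c t : ℝ} (hα : 0 < α) (hc : 0 < c) (ht : 0 < t) :
    {y : Plane | ENNReal.ofReal t < ENNReal.ofReal c * ‖y‖ₑ ^ (-α)} =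
      Metric.ball 0 ((c / t) ^ α⁻¹) := by
  ext y
  rw [Set.mem_ofPred_eq, mem_ball_zero_iff]
  rcases eq_or_ne y 0 with rfl | hy
  · have h0 : ENNReal.ofReal c ≠ 0 := by simpa using hc
    simp only [enorm_zero, norm_zero, ENNReal.zero_rpow_of_neg (neg_lt_zero.2 hα),
      ENNReal.mul_top h0, ENNReal.ofReal_lt_top, true_iff]
    positivity
  · have hy' : 0 < ‖y‖ := norm_pos_iff.2 hy
    rw [← ofReal_norm, ENNReal.ofReal_rpow_of_pos hy', ← ENNReal.ofReal_mul hc.le,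
      ENNReal.ofReal_lt_ofReal_iff (by positivity), Real.rpow_neg hy'.le,
      Real.lt_rpow_inv_iff_of_pos hy'.le (by positivity) hα, ← div_eq_mul_inv,
      lt_div_iff₀ (by positivity), lt_div_iff₀ ht, mul_comm]

lemma lintegral_rpow_mul_exp_neg_mul {a r : ℝ} (ha : 0 < a) (hr : 0 < r) :
    ∫⁻ t in Set.Ioi (0 : ℝ), ENNReal.ofReal (t ^ (a - 1) * Real.exp (-(r * t))) =
      ENNReal.ofReal ((1 / r) ^ a * Real.Gamma a) := by
  rw [← Real.integral_rpow_mul_exp_neg_mul_Ioi ha hr, ofReal_integral_eq_lintegral_ofReal]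
  -- A nonintegrable function would have Bochner integral `0` by convention, but the known value is
  -- positive.
  · have h := Real.integral_rpow_mul_exp_neg_mul_Ioi ha hr
    by_contra hn
    rw [integral_undef hn] at h
    exact absurd h (by have := Real.Gamma_pos_of_pos ha; positivity)
  · exact (ae_restrict_iff' measurableSet_Ioi).2 (ae_of_all _ fun t (ht : 0 < t) => by positivity)

/-- By the layer-cake form, level `t` contributes a disc of area `π * (a / t)^(2/α)`. Integrating
against `exp (-t)` gives the Gamma integral at `1 - 2/α`, which converges because `α > 2`. -/
lemma lintegral_one_sub_expNeg_mul_enorm_rpow {α : ℝ} (hα : 2 < α) {a : ℝ≥0∞} (ha : a ≠ ∞) :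
    ∫⁻ y : Plane, (1 - expNeg (a * ‖y‖ₑ ^ (-α))) =
      a ^ (2 / α) * ENNReal.ofReal (Real.pi * Real.Gamma (1 - 2 / α)) := by
  have hα0 : 0 < α := by linarith
  have h2α : 0 < 2 / α := by positivity
  have h2α1 : 2 / α < 1 := (div_lt_one hα0).2 hα
  rcases eq_or_ne a 0 with rfl | ha0
  · simp [ENNReal.zero_rpow_of_pos h2α]
  obtain ⟨c, hc, rfl⟩ : ∃ c : ℝ, 0 < c ∧ a = ENNReal.ofReal c :=
    ⟨a.toReal, ENNReal.toReal_pos ha0 ha, (ENNReal.ofReal_toReal ha).symm⟩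
  simp_rw [one_sub_expNeg_eq_lintegral]
  rw [lintegral_lintegral_swap]
  · have h1 : ∀ t ∈ Set.Ioi (0 : ℝ), ∫⁻ y : Plane, ENNReal.ofReal (Real.exp (-t)) *
        Set.indicator {t : ℝ | ENNReal.ofReal t < ENNReal.ofReal c * ‖y‖ₑ ^ (-α)} 1 t =
        ENNReal.ofReal (c ^ (2 / α) * Real.pi) *
          ENNReal.ofReal (t ^ ((1 - 2 / α) - 1) * Real.exp (-(1 * t))) := by
      intro t ht
      have ht' : 0 < t := ht
      have h2 : ∀ y : Plane,
          Set.indicator {t : ℝ | ENNReal.ofReal t < ENNReal.ofReal c * ‖y‖ₑ ^ (-α)}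
            (1 : ℝ → ℝ≥0∞) t = Set.indicator (Metric.ball (0 : Plane) ((c / t) ^ α⁻¹)) 1 y := by
        intro y
        rw [← setOf_lt_mul_enorm_rpow_eq_ball hα0 hc ht']
        rfl
      simp_rw [h2]
      rw [lintegral_const_mul _ (measurable_one.indicator measurableSet_ball),
        lintegral_indicator_one measurableSet_ball, EuclideanSpace.volume_ball_fin_two,
        ← ENNReal.ofReal_pow (by positivity), ← NNReal.coe_real_pi, ENNReal.ofReal_coe_nnreal,
        ← ENNReal.ofReal_coe_nnreal, NNReal.coe_real_pi,
        ← ENNReal.ofReal_mul (by positivity), ← ENNReal.ofReal_mul (by positivity),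
        ← ENNReal.ofReal_mul (by positivity)]
      congr 1
      have h3 : ((c / t) ^ α⁻¹) ^ 2 = c ^ (2 / α) * t ^ (1 - 2 / α - 1) := by
        rw [← Real.rpow_natCast, ← Real.rpow_mul (by positivity), Real.div_rpow hc.le ht'.le,
          show (1 - 2 / α - 1) = -(2 / α) by ring, Real.rpow_neg ht'.le, div_eq_mul_inv]
        congr 2 <;> push_cast <;> ring_nf
      rw [h3, one_mul]
      ring
    rw [setLIntegral_congr_fun measurableSet_Ioi h1, lintegral_const_mul _ (by fun_prop),
      lintegral_rpow_mul_exp_neg_mul (by linarith) one_pos, ← ENNReal.ofReal_mul (by positivity),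
      ENNReal.ofReal_rpow_of_pos hc, ← ENNReal.ofReal_mul (by positivity)]
    congr 1
    simp
    ring
  · refine Measurable.aemeasurable ?_
    have hs : MeasurableSet {p : Plane × ℝ |
        ENNReal.ofReal p.2 < ENNReal.ofReal c * ‖p.1‖ₑ ^ (-α)} :=
      measurableSet_lt (by fun_prop) (by fun_prop)
    have := (measurable_one (α := ℝ≥0∞)).indicator hs
    exact Measurable.mul (by fun_prop) this

lemma lintegral_ofReal_rpow_gammaMeasure {m r β : ℝ} (hm : 0 < m) (hr : 0 < r) (hβ : 0 < β) :
    ∫⁻ t, ENNReal.ofReal t ^ β ∂gammaMeasure m r =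
      ENNReal.ofReal (Real.Gamma (β + m) / Real.Gamma m * (1 / r) ^ β) := by
  have hG := Real.Gamma_pos_of_pos hm
  rw [gammaMeasure, lintegral_withDensity_eq_lintegral_mul _
    (f := gammaPDF m r) (measurable_gammaPDFReal m r).ennreal_ofReal (by fun_prop)]
  have h1 : ∀ t, (gammaPDF m r * fun t => ENNReal.ofReal t ^ β) t =
      (Set.Ioi 0).indicator (fun t => ENNReal.ofReal (r ^ m / Real.Gamma m) *
        ENNReal.ofReal (t ^ (β + m - 1) * Real.exp (-(r * t)))) t := by
    intro t
    by_cases ht : 0 < t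
    · rw [Set.indicator_of_mem (Set.mem_Ioi.2 ht), Pi.mul_apply, gammaPDF_of_nonneg ht.le,
        ENNReal.ofReal_rpow_of_pos ht, ← ENNReal.ofReal_mul (by positivity),
        ← ENNReal.ofReal_mul (by positivity), show β + m - 1 = (m - 1) + β by ring,
        Real.rpow_add ht]
      congr 1
      ring
    · rw [Set.indicator_of_notMem (by simpa using ht), Pi.mul_apply,
        ENNReal.ofReal_of_nonpos (not_lt.1 ht), ENNReal.zero_rpow_of_pos hβ, mul_zero]
  simp_rw [h1]
  rw [lintegral_indicator measurableSet_Ioi, lintegral_const_mul _ (by fun_prop),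
    lintegral_rpow_mul_exp_neg_mul (by linarith) hr, ← ENNReal.ofReal_mul (by positivity)]
  congr 1
  rw [Real.rpow_add (by positivity), one_div, Real.inv_rpow hr.le m]
  field_simp

/-! ### Gamma laws of integer shape: tails, characteristic functions, sums. -/

/-- Half of the exponential decay absorbs the power. The bound gives both integrability and the
vanishing boundary term at infinity. -/
lemma isBigO_mul_pow_mul_cexp_neg {z : ℂ} (hz : 0 < z.re) (n : ℕ) :
    (fun t : ℝ => (z * t) ^ n * Complex.exp (-(z * t))) =O[atTop]
      fun t : ℝ => Real.exp (-(z.re / 2) * t) := by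
  have h1 := (isLittleO_pow_exp_pos_mul_atTop n (half_pos hz)).isBigO
  have h2 := (h1.mul (Asymptotics.isBigO_refl (fun t : ℝ => Real.exp (-z.re * t)) atTop)).const_mul_left
    (‖z‖ ^ n)
  refine (Asymptotics.IsBigO.of_bound 1 (Eventually.of_forall fun t => ?_)).trans
    (h2.congr_right fun t => ?_)
  · rw [one_mul, norm_mul, norm_pow, norm_mul, Complex.norm_exp]
    simp only [Complex.norm_real, Complex.neg_re, Complex.mul_re, Complex.ofReal_re,
      Complex.ofReal_im, mul_zero, sub_zero, norm_mul, norm_pow, Real.norm_eq_abs,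
      Real.abs_exp, neg_mul]
    rw [mul_pow, mul_assoc, abs_norm]
  · rw [← Real.exp_add]
    congr 1
    ring

/-- The derivatives of consecutive terms telescope, leaving only the top one. -/
lemma hasDerivAt_sum_mul_pow_mul_cexp_neg (z : ℂ) (n : ℕ) (t : ℝ) :
    HasDerivAt (fun t : ℝ => ∑ k ∈ Finset.range (n + 1),
      (z * t) ^ k / (k ! : ℂ) * Complex.exp (-(z * t)))
      (-(z * ((z * t) ^ n / (n ! : ℂ) * Complex.exp (-(z * t))))) t := by
  have hl : HasDerivAt (fun t : ℝ => z * (t : ℂ)) z t := by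
    simpa using (Complex.ofRealCLM.hasDerivAt (x := t)).const_mul z
  have he : HasDerivAt (fun t : ℝ => Complex.exp (-(z * t))) (Complex.exp (-(z * t)) * -z) t :=
    hl.neg.cexp
  induction n with
  | zero => simpa [mul_comm] using he
  | succ n ih =>
    simp_rw [Finset.sum_range_succ _ (n + 1)]
    have hp := (((hl.pow (n + 1)).div_const ((n + 1)! : ℂ)).mul he)
    convert! ih.add hp using 1
    have hn : ((n + 1 : ℕ) : ℂ) ≠ 0 := by exact_mod_cast n.succ_ne_zero
    have hf : ((n ! : ℕ) : ℂ) ≠ 0 := by exact_mod_cast n.factorial_ne_zero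
    rw [Nat.factorial_succ]
    push_cast at hn ⊢
    simp only [Pi.pow_apply]
    field_simp
    ring

/-- Complex `z` lets one identity serve twice: `z = r - t * I` with `a = 0` gives the characteristic
function, and `z = r` with `a ≥ 0` gives the tail. -/
lemma integral_Ioi_mul_pow_mul_cexp_neg {z : ℂ} (hz : 0 < z.re) (n : ℕ) (a : ℝ) :
    ∫ t : ℝ in Set.Ioi a, z * ((z * t) ^ n / (n ! : ℂ) * Complex.exp (-(z * t))) =
      ∑ k ∈ Finset.range (n + 1), (z * a) ^ k / (k ! : ℂ) * Complex.exp (-(z * a)) := by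
  have hO : ∀ k : ℕ, (fun t : ℝ => (z * t) ^ k / (k ! : ℂ) * Complex.exp (-(z * t))) =O[atTop]
      fun t : ℝ => Real.exp (-(z.re / 2) * t) := fun k =>
    ((isBigO_mul_pow_mul_cexp_neg hz k).const_mul_left ((k ! : ℂ)⁻¹)).congr_left fun t => by ring
  have hexp : Tendsto (fun t : ℝ => Real.exp (-(z.re / 2) * t)) atTop (𝓝 0) :=
    Real.tendsto_exp_atBot.comp (tendsto_id.const_mul_atTop_of_neg (by linarith))
  have hcont : Continuous fun t : ℝ =>
      -(z * ((z * t) ^ n / (n ! : ℂ) * Complex.exp (-(z * t)))) := by fun_prop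
  have hint : IntegrableOn
      (fun t : ℝ => -(z * ((z * t) ^ n / (n ! : ℂ) * Complex.exp (-(z * t))))) (Set.Ioi a) :=
    (integrable_norm_iff hcont.aestronglyMeasurable).1 <|
      integrable_of_isBigO_exp_neg (half_pos hz) hcont.norm.continuousOn
        (((hO n).const_mul_left (-z)).congr_left fun t => neg_mul _ _).norm_left
  have hlim : Tendsto (fun t : ℝ => ∑ k ∈ Finset.range (n + 1),
      (z * t) ^ k / (k ! : ℂ) * Complex.exp (-(z * t))) atTop (𝓝 0) := by
    simpa using tendsto_finsetSum (Finset.range (n + 1)) fun k _ => (hO k).trans_tendsto hexp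
  have h := integral_Ioi_of_hasDerivAt_of_tendsto'
    (fun t _ => hasDerivAt_sum_mul_pow_mul_cexp_neg z n t) hint hlim
  rw [integral_neg, zero_sub, neg_inj] at h
  exact h

lemma integral_gammaMeasure_succ {E : Type*} [NormedAddCommGroup E] [NormedSpace ℝ E] {r : ℝ}
    (hr : 0 < r) (n : ℕ) (f : ℝ → E) :
    ∫ t, f t ∂gammaMeasure ((n + 1 : ℕ) : ℝ) r =
      ∫ t in Set.Ioi 0, (r * ((r * t) ^ n / n ! * Real.exp (-(r * t)))) • f t := by
  rw [gammaMeasure, integral_withDensity_eq_integral_toReal_smul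
    (f := gammaPDF _ r) (measurable_gammaPDFReal _ r).ennreal_ofReal (by simp [gammaPDF]),
    ← integral_Ici_eq_integral_Ioi, ← integral_indicator measurableSet_Ici]
  refine integral_congr_ae (ae_of_all _ fun t => ?_)
  have hn : 0 < ((n + 1 : ℕ) : ℝ) := by exact_mod_cast n.succ_pos
  by_cases ht : 0 ≤ t
  · simp only [gammaPDF, ENNReal.toReal_ofReal (gammaPDFReal_nonneg hn hr t)]
    rw [Set.indicator_of_mem (Set.mem_Ici.2 ht), gammaPDFReal, if_pos ht]
    congr 1
    push_cast
    rw [Real.Gamma_nat_eq_factorial, add_sub_cancel_right, Real.rpow_natCast, ← Nat.cast_succ,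
      Real.rpow_natCast, Nat.succ_eq_add_one, pow_succ]
    ring
  · rw [Set.indicator_of_notMem (by simpa using ht)]
    simp [gammaPDF_of_neg (not_le.1 ht)]

lemma charFun_gammaMeasure_succ {r : ℝ} (hr : 0 < r) (n : ℕ) (t : ℝ) :
    charFun (gammaMeasure ((n + 1 : ℕ) : ℝ) r) t = (r / (r - t * Complex.I)) ^ (n + 1) := by
  set z : ℂ := r - t * Complex.I with hz
  have hre : 0 < z.re := by simpa [hz] using hr
  have hz0 : z ≠ 0 := fun h => by simp [h] at hre
  have h := integral_Ioi_mul_pow_mul_cexp_neg hre n 0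
  have h0 : ∑ k ∈ Finset.range (n + 1), (z * (0 : ℝ)) ^ k / (k ! : ℂ) *
      Complex.exp (-(z * (0 : ℝ))) = 1 := by
    simp [Finset.sum_range_succ']
  rw [h0] at h
  -- The factor `1` is expanded into the normalised integral `h`, so that the integrands can be
  -- compared pointwise.
  rw [charFun_apply_real, integral_gammaMeasure_succ hr, ← mul_one ((r / z) ^ (n + 1)), ← h,
    ← integral_const_mul]
  refine integral_congr_ae (ae_of_all _ fun x => ?_)
  simp only [Complex.real_smul]
  push_cast
  have he : Complex.exp (-(z * x)) = Complex.exp (-(r * x)) * Complex.exp (t * x * Complex.I) := by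
    rw [← Complex.exp_add, hz]
    congr 1
    ring
  rw [he, div_pow, mul_pow, mul_pow, pow_succ, pow_succ]
  field_simp

lemma gammaMeasure_succ_Ici {r : ℝ} (hr : 0 < r) (n : ℕ) {a : ℝ} (ha : 0 ≤ a) :
    (gammaMeasure ((n + 1 : ℕ) : ℝ) r).real (Set.Ici a) =
      ∑ k ∈ Finset.range (n + 1), (r * a) ^ k / k ! * Real.exp (-(r * a)) := by
  have h := integral_Ioi_mul_pow_mul_cexp_neg (z := r) (by simpa using hr) n a
  have h1 : ∫ t : ℝ in Set.Ioi a, r * ((r * t) ^ n / n ! * Real.exp (-(r * t))) =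
      ∑ k ∈ Finset.range (n + 1), (r * a) ^ k / k ! * Real.exp (-(r * a)) := by
    have h2 : ∀ t : ℝ, (r : ℂ) * ((r * t) ^ n / (n ! : ℂ) * Complex.exp (-(r * t))) =
        ((r * ((r * t) ^ n / n ! * Real.exp (-(r * t))) : ℝ) : ℂ) := fun t => by push_cast; rfl
    simp_rw [h2] at h
    rw [integral_complex_ofReal] at h
    exact_mod_cast h
  rw [← h1, ← integral_indicator_one measurableSet_Ici, integral_gammaMeasure_succ hr,
    ← integral_Ici_eq_integral_Ioi, ← integral_Ici_eq_integral_Ioi,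
    ← integral_indicator measurableSet_Ici, ← integral_indicator measurableSet_Ici]
  refine integral_congr_ae (ae_of_all _ fun t => ?_)
  by_cases h : a ≤ t
  · simp [Set.indicator, h, ha.trans h]
  · simp [Set.indicator, h]

/-- A sum of independent Gamma variables with a common rate and a common positive integer shape is
Gamma distributed. -/
lemma map_sum_eq_gammaMeasure {Ω : Type*} [MeasurableSpace Ω] {μ : Measure Ω} {N m : ℕ}
    (hN : 1 ≤ N) (hm : 1 ≤ m) {r : ℝ} (hr : 0 < r) {g : Fin N → Ω → ℝ}
    (hg : ∀ n, Measurable (g n)) (hlaw : ∀ n, μ.map (g n) = gammaMeasure m r)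
    (hind : iIndepFun g μ) :
    μ.map (fun ω => ∑ n, g n ω) = gammaMeasure ((N * m : ℕ) : ℝ) r := by
  have : IsProbabilityMeasure μ := hind.isProbabilityMeasure
  have hNm : 1 ≤ N * m := Nat.mul_pos hN hm
  have : IsProbabilityMeasure (gammaMeasure ((N * m : ℕ) : ℝ) r) :=
    isProbabilityMeasure_gammaMeasure (by exact_mod_cast hNm) hr
  have : IsProbabilityMeasure (μ.map (fun ω => ∑ n, g n ω)) :=
    Measure.isProbabilityMeasure_map (by fun_prop)
  refine Measure.ext_of_charFun ?_
  ext t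
  have key : ∀ k : ℕ, 1 ≤ k →
      charFun (gammaMeasure (k : ℝ) r) t = (r / (r - t * Complex.I)) ^ k := fun k hk => by
    obtain ⟨j, rfl⟩ := Nat.exists_eq_add_of_le' hk
    exact charFun_gammaMeasure_succ hr j t
  rw [hind.charFun_map_fun_sum_eq_prod fun n => (hg n).aemeasurable, Finset.prod_apply]
  simp_rw [hlaw]
  rw [key m hm, key _ hNm, Finset.prod_const, Finset.card_univ, Fintype.card_fin, ← pow_mul,
    mul_comm m N]

/-! ### Regrouping independent families. -/

/-- Fixing `A = a` leaves the law of `(B, C)` unchanged, so the event factors for each `a`;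
integrate over `a`. It is used with locations `A`, desired gains `B` and interferer gains `C`. -/
lemma indepFun_prodMk_of_indepFun_prodMk {Ω α β γ : Type*} [MeasurableSpace Ω]
    [MeasurableSpace α] [MeasurableSpace β] [MeasurableSpace γ] {μ : Measure Ω}
    [IsProbabilityMeasure μ] {A : Ω → α} {B : Ω → β} {C : Ω → γ} (hA : Measurable A)
    (hB : Measurable B) (hC : Measurable C) (hABC : IndepFun A (fun ω => (B ω, C ω)) μ)
    (hBC : IndepFun B C μ) : IndepFun B (fun ω => (A ω, C ω)) μ := by
  have hAC : IndepFun A C μ := hABC.comp measurable_id measurable_snd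
  have := Measure.isProbabilityMeasure_map (μ := μ) hA.aemeasurable
  have := Measure.isProbabilityMeasure_map (μ := μ) hC.aemeasurable
  have := Measure.isProbabilityMeasure_map (μ := μ) (hB.prodMk hC).aemeasurable
  rw [indepFun_iff_measure_inter_preimage_eq_mul]
  intro s t hs ht
  have hS : MeasurableSet {p : α × β × γ | p.2.1 ∈ s ∧ (p.1, p.2.2) ∈ t} :=
    ((measurable_fst.comp measurable_snd) hs).inter
      ((measurable_fst.prodMk (measurable_snd.comp measurable_snd)) ht)
  have h1 : μ (B ⁻¹' s ∩ (fun ω => (A ω, C ω)) ⁻¹' t) =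
      ((μ.map A).prod (μ.map fun ω => (B ω, C ω)))
        {p : α × β × γ | p.2.1 ∈ s ∧ (p.1, p.2.2) ∈ t} := by
    rw [← (indepFun_iff_map_prod_eq_prod_map_map hA.aemeasurable
      (hB.prodMk hC).aemeasurable).1 hABC, Measure.map_apply (hA.prodMk (hB.prodMk hC)) hS]
    rfl
  have h2 : μ ((fun ω => (A ω, C ω)) ⁻¹' t) = ((μ.map A).prod (μ.map C)) t := by
    rw [← (indepFun_iff_map_prod_eq_prod_map_map hA.aemeasurable hC.aemeasurable).1 hAC,
      Measure.map_apply (hA.prodMk hC) ht]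
  rw [h1, h2, Measure.prod_apply hS, Measure.prod_apply ht,
    ← lintegral_const_mul _ (measurable_measure_prodMk_left ht)]
  refine lintegral_congr fun a => ?_
  rw [Measure.map_apply (hB.prodMk hC) (measurable_prodMk_left hS),
    Measure.map_apply hC (measurable_prodMk_left ht)]
  exact hBC.measure_inter_preimage_eq_mul s (Prod.mk a ⁻¹' t) hs (measurable_prodMk_left ht)

lemma comap_fun_eq_iSup_comap {Ω ι : Type*} {β : ι → Type*} [∀ i, MeasurableSpace (β i)]
    (f : ∀ i, Ω → β i) :
    MeasurableSpace.comap (fun ω i => f i ω) MeasurableSpace.pi =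
      ⨆ i, MeasurableSpace.comap (f i) inferInstance := by
  rw [MeasurableSpace.pi, MeasurableSpace.comap_iSup]
  simp_rw [MeasurableSpace.comap_comp]
  rfl

lemma iIndepFun.indepFun_sumElim {Ω ι κ β : Type*} [MeasurableSpace Ω] [MeasurableSpace β]
    {μ : Measure Ω} {f : ι → Ω → β} {g : κ → Ω → β} (hf : ∀ i, Measurable (f i))
    (hg : ∀ i, Measurable (g i)) (h : iIndepFun (Sum.elim f g) μ) :
    IndepFun (fun ω i => f i ω) (fun ω i => g i ω) μ := by
  rw [IndepFun_iff_Indep, comap_fun_eq_iSup_comap, comap_fun_eq_iSup_comap]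
  have hd : Disjoint (Set.range (Sum.inl : ι → ι ⊕ κ)) (Set.range (Sum.inr : κ → ι ⊕ κ)) :=
    Set.isCompl_range_inl_range_inr.disjoint
  have := indep_iSup_of_disjoint (fun j => ?_) h.iIndep hd
  · rw [iSup_range, iSup_range] at this
    exact this
  · cases j with
    | inl i => exact (hf i).comap_le
    | inr i => exact (hg i).comap_le

/-! ### Laplace transform and finiteness of the interference. -/

section Model

variable {Ω : Type*} [MeasurableSpace Ω] {μ : Measure Ω} {α d lam m : ℝ}
  {x : ℕ → Ω → Plane} {h : ℕ → Ω → ℝ}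

lemma measurable_interference (hx : ∀ i, Measurable (x i)) (hh : ∀ i, Measurable (h i)) :
    Measurable (interference α d x h) := by
  unfold interference
  exact measurable_const.mul (Measurable.tsum fun i => by fun_prop)

/-- The Laplace transform of the interference power. -/
theorem IsPlanarPoissonProcess.lintegral_expNeg_interference [IsProbabilityMeasure μ]
    (hP : IsPlanarPoissonProcess μ lam x) (hlam : 0 ≤ lam) (hα : 2 < α) (hd : 0 < d) (hm : 0 < m)
    (hh : ∀ i, Measurable (h i)) (hlaw : ∀ i, μ.map (h i) = gammaMeasure m m)
    (hind : iIndepFun h μ) (hxh : IndepFun (fun ω i => x i ω) (fun ω i => h i ω) μ)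
    {s : ℝ} (hs : 0 < s) :
    ∫⁻ ω, expNeg (ENNReal.ofReal s * interference α d x h ω) ∂μ =
      ENNReal.ofReal (Real.exp (-(lam * Real.pi * d ^ 2 * Real.Gamma (1 - 2 / α) *
        (Real.Gamma (2 / α + m) / Real.Gamma m) * (s / m) ^ (2 / α)))) := by
  have hα0 : 0 < α := by linarith
  have h2α : 0 < 2 / α := by positivity
  have h2α1 : 2 / α < 1 := (div_lt_one hα0).2 hα
  have hG1 := Real.Gamma_pos_of_pos (show 0 < 1 - 2 / α by linarith)
  have hG2 := Real.Gamma_pos_of_pos (show 0 < 2 / α + m by linarith)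
  have hG3 := Real.Gamma_pos_of_pos hm
  have := isProbabilityMeasure_gammaMeasure hm hm
  have h1 : ∀ ω, ENNReal.ofReal s * interference α d x h ω =
      ∑' i, ENNReal.ofReal (h i ω) * (ENNReal.ofReal (s * d ^ α) * ‖x i ω‖ₑ ^ (-α)) := fun ω => by
    rw [interference, ← mul_assoc, ← ENNReal.ofReal_mul hs.le, ← ENNReal.tsum_mul_left]
    exact tsum_congr fun i => by ring
  simp_rw [h1]
  rw [hP.lintegral_expNeg_tsum_mul hlam hh hlaw hind hxh
    (f := fun y => ENNReal.ofReal (s * d ^ α) * ‖y‖ₑ ^ (-α)) (by fun_prop),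
    lintegral_lintegral_swap (Measurable.aemeasurable (by
      exact measurable_const.sub (measurable_expNeg.comp (by fun_prop))))]
  -- With the plane integral taken first, a gain `t` enters only through `t^(2/α)`, so the outer
  -- integral is a Gamma moment.
  have h2 : ∀ t : ℝ, ∫⁻ y : Plane,
      (1 - expNeg (ENNReal.ofReal t * (ENNReal.ofReal (s * d ^ α) * ‖y‖ₑ ^ (-α)))) =
      ENNReal.ofReal ((s * d ^ α) ^ (2 / α) * (Real.pi * Real.Gamma (1 - 2 / α))) *
        ENNReal.ofReal t ^ (2 / α) := fun t => by
    simp_rw [← mul_assoc]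
    rw [lintegral_one_sub_expNeg_mul_enorm_rpow hα
      (ENNReal.mul_ne_top ENNReal.ofReal_ne_top ENNReal.ofReal_ne_top),
      ENNReal.mul_rpow_of_nonneg _ _ h2α.le,
      ENNReal.ofReal_rpow_of_pos (show 0 < s * d ^ α by positivity),
      mul_assoc, ← ENNReal.ofReal_mul (by positivity), mul_comm, mul_assoc (_ ^ _)]
  simp_rw [h2]
  rw [lintegral_const_mul _ (by fun_prop), lintegral_ofReal_rpow_gammaMeasure hm hm h2α,
    ← ENNReal.ofReal_mul (by positivity), ← ENNReal.ofReal_mul hlam,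
    expNeg_ofReal (by positivity)]
  congr 3
  have hdα : (s * d ^ α) ^ (2 / α) = s ^ (2 / α) * d ^ 2 := by
    rw [Real.mul_rpow hs.le (by positivity), ← Real.rpow_mul hd.le, mul_div_cancel₀ _ hα0.ne']
    norm_num
  rw [hdα, div_eq_mul_one_div s m, Real.mul_rpow hs.le (by positivity)]
  ring

/-- For `s > 0`, `expNeg (s * I)` is at most the indicator of `I < ∞`, and its expectation tends to
`1` as `s` decreases to `0`. -/
lemma IsPlanarPoissonProcess.interference_ne_top [IsProbabilityMeasure μ]
    (hP : IsPlanarPoissonProcess μ lam x) (hlam : 0 ≤ lam) (hα : 2 < α) (hd : 0 < d) (hm : 0 < m)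
    (hh : ∀ i, Measurable (h i)) (hlaw : ∀ i, μ.map (h i) = gammaMeasure m m)
    (hind : iIndepFun h μ) (hxh : IndepFun (fun ω i => x i ω) (fun ω i => h i ω) μ) :
    ∀ᵐ ω ∂μ, interference α d x h ω ≠ ∞ := by
  have hms : MeasurableSet {ω | interference α d x h ω ≠ ∞} :=
    (measurable_interference hP.measurable_point hh (measurableSet_singleton ∞)).compl
  have hα0 : 0 < α := by linarith
  have hle : ∀ s : ℝ, 0 < s →
      ENNReal.ofReal (Real.exp (-(lam * Real.pi * d ^ 2 * Real.Gamma (1 - 2 / α) *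
        (Real.Gamma (2 / α + m) / Real.Gamma m) * (s / m) ^ (2 / α)))) ≤
      μ {ω | interference α d x h ω ≠ ∞} := fun s hs => by
    rw [← hP.lintegral_expNeg_interference hlam hα hd hm hh hlaw hind hxh hs,
      ← lintegral_indicator_one hms]
    refine lintegral_mono fun ω => ?_
    by_cases hω : interference α d x h ω = ∞
    · simp [hω, ENNReal.mul_top, hs]
    · rw [Set.indicator_of_mem (by exact hω)]
      exact expNeg_le_one _
  have hlim : Tendsto (fun s : ℝ =>
      ENNReal.ofReal (Real.exp (-(lam * Real.pi * d ^ 2 * Real.Gamma (1 - 2 / α) *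
        (Real.Gamma (2 / α + m) / Real.Gamma m) * (s / m) ^ (2 / α))))) (𝓝[>] 0) (𝓝 1) := by
    have hc : Continuous fun s : ℝ =>
        ENNReal.ofReal (Real.exp (-(lam * Real.pi * d ^ 2 * Real.Gamma (1 - 2 / α) *
        (Real.Gamma (2 / α + m) / Real.Gamma m) * (s / m) ^ (2 / α)))) := by
      have : Continuous fun s : ℝ => (s / m) ^ (2 / α) :=
        (continuous_id.div_const m).rpow_const fun _ => Or.inr (by positivity)
      exact ENNReal.continuous_ofReal.comp (by fun_prop)
    have h0 := hc.tendsto 0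
    rw [zero_div, Real.zero_rpow (by positivity), mul_zero, neg_zero, Real.exp_zero,
      ENNReal.ofReal_one] at h0
    exact h0.mono_left nhdsWithin_le_nhds
  have h1 : 1 ≤ μ {ω | interference α d x h ω ≠ ∞} :=
    le_of_tendsto hlim (by filter_upwards [self_mem_nhdsWithin] with s hs using hle s hs)
  exact (mem_ae_iff_prob_eq_one hms).2 (le_antisymm prob_le_one h1)

end Model

/-! ### From the Laplace transform to the success probability. -/

lemma gammaMeasure_Iio_zero (a r : ℝ) : gammaMeasure a r (Set.Iio 0) = 0 := by
  rw [gammaMeasure, withDensity_apply _ measurableSet_Iio, lintegral_gammaPDF_of_nonpos le_rfl]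

lemma measureReal_setOf_le_eq_integral {Ω : Type*} [MeasurableSpace Ω] {μ : Measure Ω}
    [IsProbabilityMeasure μ] {Y G : Ω → ℝ} (hY : Measurable Y) (hG : Measurable G)
    (hind : IndepFun Y G μ) :
    μ.real {ω | Y ω ≤ G ω} = ∫ ω, (μ.map G).real (Set.Ici (Y ω)) ∂μ := by
  have := Measure.isProbabilityMeasure_map (μ := μ) hG.aemeasurable
  have hS : MeasurableSet {p : ℝ × ℝ | p.1 ≤ p.2} := measurableSet_le measurable_fst measurable_snd
  have hm : Measurable fun y => (μ.map G) (Set.Ici y) := measurable_measure_prodMk_left hS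
  have h1 : μ {ω | Y ω ≤ G ω} = ∫⁻ ω, (μ.map G) (Set.Ici (Y ω)) ∂μ := by
    rw [← lintegral_map (f := fun y => (μ.map G) (Set.Ici y)) hm hY]
    have : μ {ω | Y ω ≤ G ω} = ((μ.map Y).prod (μ.map G)) {p : ℝ × ℝ | p.1 ≤ p.2} := by
      rw [← (indepFun_iff_map_prod_eq_prod_map_map hY.aemeasurable hG.aemeasurable).1 hind,
        Measure.map_apply (hY.prodMk hG) hS]
      rfl
    rw [this, Measure.prod_apply hS]
    rfl
  rw [measureReal_def, h1, ← integral_toReal (f := fun ω => (μ.map G) (Set.Ici (Y ω))) (hm.comp hY).aemeasurable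
    (ae_of_all _ fun ω => measure_lt_top _ _)]
  rfl

/-- The probability that an independent Gamma variable of integer shape `M` exceeds `Y ≥ 0`, in
terms of the derivatives of the Laplace transform of `r * Y`. -/
lemma measureReal_le_eq_sum_iteratedDeriv {Ω : Type*} [MeasurableSpace Ω] {μ : Measure Ω}
    [IsProbabilityMeasure μ] {Y G : Ω → ℝ} {r : ℝ} {M : ℕ} (hr : 0 < r) (hM : 1 ≤ M)
    (hY : Measurable Y) (hY0 : ∀ ω, 0 ≤ Y ω) (hG : Measurable G) (hind : IndepFun Y G μ)
    (hlaw : μ.map G = gammaMeasure M r) {L : ℝ → ℝ}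
    (hL : ∀ s, 0 < s → ∫ ω, Real.exp (-(s * (r * Y ω))) ∂μ = L s) :
    μ.real {ω | Y ω ≤ G ω} =
      ∑ k ∈ Finset.range M, ((-1 : ℝ) ^ k / (k ! : ℝ)) * iteratedDeriv k L 1 := by
  obtain ⟨n, rfl⟩ := Nat.exists_eq_add_of_le' hM
  let Z : Ω → ℝ := fun ω => -(r * Y ω)
  have hZ : Measurable Z := by fun_prop
  have hset : Set.Ioi 0 ⊆ integrableExpSet Z μ := fun s (hs : 0 < s) => by
    refine Integrable.of_bound (C := 1) (by fun_prop) (ae_of_all _ fun ω => ?_)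
    rw [Real.norm_eq_abs, Real.abs_exp, Real.exp_le_one_iff]
    have := hY0 ω
    simp only [Z, mul_neg, Left.neg_nonpos_iff]
    positivity
  have hint : (1 : ℝ) ∈ interior (integrableExpSet Z μ) :=
    interior_maximal hset isOpen_Ioi (Set.mem_Ioi.2 one_pos)
  -- Derivatives at `1` see only the germ of `L` there, so its values for `s ≤ 0` are irrelevant.
  have hLe : L =ᶠ[𝓝 1] mgf Z μ := by
    filter_upwards [Ioi_mem_nhds one_pos] with s hs
    rw [← hL s hs, mgf]
    simp only [Z, mul_neg]
  rw [measureReal_setOf_le_eq_integral hY hG hind, hlaw]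
  simp_rw [gammaMeasure_succ_Ici hr n (hY0 _)]
  have hk : ∀ k : ℕ, ∀ ω, (r * Y ω) ^ k / k ! * Real.exp (-(r * Y ω)) =
      ((-1 : ℝ) ^ k / (k ! : ℝ)) * (Z ω ^ k * Real.exp (1 * Z ω)) := fun k ω => by
    simp only [Z, one_mul]
    rw [neg_pow (r * Y ω)]
    have : ((-1 : ℝ) ^ k) * (-1) ^ k = 1 := by rw [← mul_pow]; norm_num
    linear_combination (-(r * Y ω) ^ k / k ! * Real.exp (-(r * Y ω))) * this
  simp_rw [hk]
  rw [integral_finsetSum _ fun k _ =>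
    (integrable_pow_mul_exp_of_mem_interior_integrableExpSet hint k).const_mul _]
  refine Finset.sum_congr rfl fun k _ => ?_
  rw [integral_const_mul, hLe.iteratedDeriv_eq, iteratedDeriv_mgf hint]

theorem mainTheorem4 {Ω : Type*} [MeasurableSpace Ω] (μ : Measure Ω) [IsProbabilityMeasure μ]
    (N mD : ℕ) (hN : 1 ≤ N) (hmD : 1 ≤ mD)
    (mI lam α d SNR T : ℝ) (hmI : 0 < mI) (hlam : 0 < lam) (hα : 2 < α) (hd : 0 < d)
    (hSNR : 0 < SNR) (hT : 0 < T)
    (x : ℕ → Ω → Plane) (g : Fin N → Ω → ℝ) (h : Fin N → ℕ → Ω → ℝ)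
    (hmodel : IsFullCorrelationModel μ N lam (mD : ℝ) mI x g h) :
    μ.real {ω | ENNReal.ofReal T ≤ sinrMRC α d SNR x g h ω} =
      ∑ k ∈ Finset.range (N * mD), ((-1 : ℝ) ^ k / (k ! : ℝ)) *
        iteratedDeriv k (fun s : ℝ =>
          Real.exp (-(s * mD * T / SNR) -
            lam * Real.pi * d ^ 2 * s ^ (2 / α) * T ^ (2 / α) * Real.Gamma (1 - 2 / α) *
              (Real.Gamma (2 / α + mI) / Real.Gamma mI) * ((mD : ℝ) / mI) ^ (2 / α))) 1 := by
  have hmD0 : (0 : ℝ) < mD := by exact_mod_cast hmD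
  -- A reference branch: independence is assumed one branch at a time, and all other branches agree
  -- with this one almost surely.
  let n₀ : Fin N := ⟨0, hN⟩
  have hxm := hmodel.poisson.measurable_point
  have hhm := hmodel.measurable_h n₀
  have hgm := hmodel.measurable_g
  have hg : iIndepFun g μ := (hmodel.indep_gains n₀).precomp (g := Sum.inl) Sum.inl_injective
  have hh : iIndepFun (h n₀) μ := (hmodel.indep_gains n₀).precomp (g := Sum.inr) Sum.inr_injective
  have hxm' : Measurable fun ω i => x i ω := measurable_pi_lambda _ hxm
  have hhm' : Measurable fun ω i => h n₀ i ω := measurable_pi_lambda _ hhm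
  have hgm' : Measurable fun ω n => g n ω := measurable_pi_lambda _ hgm
  have hxgh : IndepFun (fun ω i => x i ω) (fun ω => ((fun n => g n ω), fun i => h n₀ i ω)) μ :=
    (hmodel.indep_locations n₀).comp measurable_id
      (ψ := fun v : Fin N ⊕ ℕ → ℝ => ((fun n => v (Sum.inl n)), fun i => v (Sum.inr i)))
      (by fun_prop)
  have hxh : IndepFun (fun ω i => x i ω) (fun ω i => h n₀ i ω) μ :=
    hxgh.comp measurable_id measurable_snd
  have hgxh := indepFun_prodMk_of_indepFun_prodMk hxm' hgm' hhm' hxgh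
    (iIndepFun.indepFun_sumElim hgm hhm (hmodel.indep_gains n₀))
  let I : Ω → ℝ≥0∞ := interference α d x (h n₀)
  have hIm : Measurable I := measurable_interference hxm hhm
  have hItop : ∀ᵐ ω ∂μ, I ω ≠ ∞ := hmodel.poisson.interference_ne_top hlam.le hα hd hmI hhm
    (hmodel.law_h n₀) hh hxh
  -- `toReal` sends `∞` to `0`, which by `hItop` matters only on a null set.
  let Y : Ω → ℝ := fun ω => T * ((I ω).toReal + SNR⁻¹)
  let G : Ω → ℝ := fun ω => ∑ n, g n ω
  have hYm : Measurable Y := by fun_prop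
  have hGm : Measurable G := by fun_prop
  have hYG : IndepFun Y G μ := by
    -- Taking the sequence space itself as sample space exhibits `I` as a measurable function of
    -- locations and gains.
    have hF : Measurable (interference α d
        (fun i (p : (ℕ → Plane) × (ℕ → ℝ)) => p.1 i) (fun i p => p.2 i)) :=
      measurable_interference (fun i => by fun_prop) (fun i => by fun_prop)
    exact (hgxh.comp (by fun_prop : Measurable fun v : Fin N → ℝ => ∑ n, v n)
      (((hF.ennreal_toReal).add_const SNR⁻¹).const_mul T)).symm
  have hevent : {ω | ENNReal.ofReal T ≤ sinrMRC α d SNR x g h ω} =ᵐ[μ] {ω | Y ω ≤ G ω} := by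
    have hcorr : ∀ᵐ ω ∂μ, ∀ n i, h n i ω = h n₀ i ω :=
      ae_all_iff.2 fun n => ae_all_iff.2 fun i => hmodel.full_correlation n n₀ i
    have hg0 : ∀ᵐ ω ∂μ, ∀ n, 0 ≤ g n ω := ae_all_iff.2 fun n => by
      rw [ae_iff]
      have := gammaMeasure_Iio_zero mD mD
      rw [← hmodel.law_g n, Measure.map_apply (hgm n) measurableSet_Iio] at this
      simpa [Set.preimage] using this
    filter_upwards [hcorr, hg0, hItop] with ω hω hgω hIω
    refine propext ?_
    change ENNReal.ofReal T ≤ sinrMRC α d SNR x g h ω ↔ Y ω ≤ G ω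
    have hsinr : sinrMRC α d SNR x g h ω =
        ENNReal.ofReal (G ω) / (I ω + ENNReal.ofReal SNR⁻¹) := by
      rw [sinrMRC, ENNReal.ofReal_sum_of_nonneg fun n _ => hgω n]
      simp_rw [div_eq_mul_inv, Finset.sum_mul]
      refine Finset.sum_congr rfl fun n _ => ?_
      simp only [I, interference, hω n]
    -- The noise keeps the denominator nonzero and `hIω` keeps it finite, so the division in `[0,
    -- ∞]` can be cleared.
    have hpos : ENNReal.ofReal SNR⁻¹ ≠ 0 := by simpa using hSNR
    rw [hsinr, ENNReal.le_div_iff_mul_le (Or.inl (by simp [hpos])) (Or.inl (by simp [hIω])),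
      ← ENNReal.ofReal_toReal hIω, ← ENNReal.ofReal_add ENNReal.toReal_nonneg (by positivity),
      ← ENNReal.ofReal_mul hT.le, ENNReal.ofReal_le_ofReal_iff (Finset.sum_nonneg fun n _ => hgω n)]
  rw [measureReal_congr hevent]
  refine measureReal_le_eq_sum_iteratedDeriv hmD0 (Nat.mul_pos hN hmD) hYm
    (fun ω => by positivity) hGm hYG
    (map_sum_eq_gammaMeasure hN hmD hmD0 hgm hmodel.law_g hg) fun s hs => ?_
  -- The coefficient of `I` in `s * (mD * Y)`; the noise part is the constant `s * mD * T / SNR`.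
  have hc : 0 < s * mD * T := by positivity
  have hLap := hmodel.poisson.lintegral_expNeg_interference hlam.le hα hd hmI hhm
    (hmodel.law_h n₀) hh hxh hc
  have hLapReal : ∫ ω, Real.exp (-(s * mD * T * (I ω).toReal)) ∂μ =
      Real.exp (-(lam * Real.pi * d ^ 2 * Real.Gamma (1 - 2 / α) *
        (Real.Gamma (2 / α + mI) / Real.Gamma mI) * (s * mD * T / mI) ^ (2 / α))) := by
    rw [integral_eq_lintegral_of_nonneg_ae (ae_of_all _ fun ω => (Real.exp_pos _).le)
      (Measurable.aestronglyMeasurable (by fun_prop)),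
      ← ENNReal.toReal_ofReal (Real.exp_pos _).le, ← hLap]
    congr 1
    refine lintegral_congr_ae ?_
    filter_upwards [hItop] with ω hω
    change _ = expNeg (ENNReal.ofReal (s * mD * T) * I ω)
    rw [← expNeg_ofReal (by positivity), ENNReal.ofReal_mul hc.le, ENNReal.ofReal_toReal hω]
  have hsplit : ∀ ω, Real.exp (-(s * (mD * Y ω))) =
      Real.exp (-(s * mD * T / SNR)) * Real.exp (-(s * mD * T * (I ω).toReal)) := fun ω => by
    rw [← Real.exp_add]
    congr 1
    simp only [Y]
    ring
  simp_rw [hsplit]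
  rw [integral_const_mul, hLapReal, ← Real.exp_add]
  congr 1
  rw [show s * mD * T / mI = s * T * (mD / mI) by ring, Real.mul_rpow (by positivity)
    (by positivity), Real.mul_rpow hs.le hT.le]
  ring
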